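/- **Conventions.** Semigroups are nonempty, and $S^1$ denotes the semigroup $S$ with an identity adjoined if necessary. A pseudovariety is a class of finite semigroups closed under subsemigroups, homomorphic images and finite direct products. For a semigroup $S$, $x,y\in S$ and $z_1,z_2,\ldots\in S^1$, put $\lambda_0=x$, $\rho_0=y$, $\lambda_{n+1}=\lambda_n z_{n+1}\rho_n$ and $\rho_{n+1}=\rho_n z_{n+1}\lambda_n$. Let $\mathsf{MN}$ be the pseudovariety of finite semigroups that are nilpotent in the sense of Mal'cev, i.e. for which there is a positive integer $n$ with $\lambda_n=\rho_n$ for all $x,y\in S$ and $z_1,\ldots,z_n\in S^1$. Let $\mathsf{J}$ be the pseudovariety of finite $\mathcal{J}$-trivial semigroups (those in which $S^1xS^1=S^1yS^1$ implies $x=y$), and $\mathsf{G}_{nil}$ the pseudovariety of finite nilpotent groups. The Mal'cev product $\mathsf{J}\mathbin{\text{ⓜ}}\mathsf{G}_{nil}$ is the pseudovariety of all finite semigroups $S$ for which there are $G\in\mathsf{G}_{nil}$ and a relational morphism $\tau$ from $S$ to $G$ (a subsemigroup of $S\times G$ projecting onto $S$) such that $\tau^{-1}(e)\in\mathsf{J}$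 for every idempotent $e$ of $G$, that is, for $e=1$. In the full transformation semigroup on $\{1,\ldots,n\}\cup\{\theta\}$ (maps acting on the right, so that the left factor of a product is applied first), let $B_n=\mathcal{M}^0(\{1\},n,n;I_n)$ be the subsemigroup consisting of the constant map with value $\theta$ and, for $1\le i,j\le n$, the map sending $i$ to $j$ and every other point to $\theta$. A cycle $(j_1,\ldots,j_k)$ is written as usual; $(j_1,\ldots,j_k,\theta)$ means $j_1\mapsto j_2\mapsto\cdots\mapsto j_k\mapsto\theta$; points that are not mentioned, and $\theta$, are sent to $\theta$; and $1$ denotes the identity map. Let $$N_2=B_{16}\cup\langle a_2,b_2\rangle\cup\{1\},\qquad a_2=(1,2,\ldots,15),\quad b_2=(16,1,2,\ldots,15,\theta),$$ on $\{1,\ldots,16\}\cup\{\theta\}$, where $\langle a_2,b_2\rangle$ is the subsemigroup generated by $a_2$ and $b_2$, and $$M_3=B_4\cup\{c_3,d_3,1\},\qquad c_3=(1,2,\theta)(3,4,\theta),\quad d_3=(1,4,\theta)(3,2,\theta),$$ on $\{1,\ldots,4\}\cup\{\theta\}$. Both are finite semigroups. **Theorem.** The pseudovarieties $\mathsf{MN}$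 and $\mathsf{J}\mathbin{\text{ⓜ}}\mathsf{G}_{nil}$ are incomparable: neither is contained in the other. More precisely, $N_2\in\mathsf{MN}$ but $N_2\notin\mathsf{J}\mathbin{\text{ⓜ}}\mathsf{G}_{nil}$, and $M_3\in\mathsf{J}\mathbin{\text{ⓜ}}\mathsf{G}_{nil}$ but $M_3\notin\mathsf{MN}$. -/

import Mathlib

universe u

namespace FinSemigroup

/-- A pseudovariety of semigroups: a class of finite nonempty semigroups closed under taking
(nonempty) subsemigroups, homomorphic images and finite direct products. The first closure
property is phrased with injective homomorphisms, so that the class is isomorphism-invariant. -/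
structure Pseudovariety where
  Mem : (S : Type u) → [Semigroup S] → Prop
  finite : ∀ (S : Type u) [Semigroup S], Mem S → Finite S
  nonempty : ∀ (S : Type u) [Semigroup S], Mem S → Nonempty S
  sub : ∀ (S T : Type u) [Semigroup S] [Semigroup T] (f : T →ₙ* S),
    Nonempty T → Function.Injective f → Mem S → Mem T
  quot : ∀ (S T : Type u) [Semigroup S] [Semigroup T] (f : S →ₙ* T),
    Function.Surjective f → Mem S → Mem T
  pi : ∀ (ι : Type) [Finite ι] (S : ι → Type u) [∀ i, Semigroup (S i)],
    (∀ i, Mem (S i)) → Mem (∀ i, S i)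

/-- Inclusion of pseudovarieties. -/
instance : LE Pseudovariety.{u} :=
  ⟨fun V W => ∀ (S : Type u) [Semigroup S], V.Mem S → W.Mem S⟩

/-! ### Mal'cev nilpotent semigroups -/

/-- The pair `(λ_n, ρ_n)`: `λ_0 = x`, `ρ_0 = y`, `λ_{n+1} = λ_n z_{n+1} ρ_n` and
`ρ_{n+1} = ρ_n z_{n+1} λ_n`. The parameter `z_{k+1}` is `z k`, so only `z 0, …, z (n - 1)`
occur in the `n`-th pair. -/
def malcevSeq {M : Type*} [Monoid M] (x y : M) (z : ℕ → M) : ℕ → M × M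
  | 0 => (x, y)
  | n + 1 => ((malcevSeq x y z n).1 * z n * (malcevSeq x y z n).2,
      (malcevSeq x y z n).2 * z n * (malcevSeq x y z n).1)

/-- `S` is nilpotent in the sense of Mal'cev: for some positive `n`, `λ_n = ρ_n` for all
`x, y ∈ S` and all parameters in `S¹`. Here `S¹` is `WithOne S`; if `S` already has an identity,
the adjoined identity takes no other values in these products than the identity of `S` does. -/
def IsMalcevNilpotent (S : Type*) [Semigroup S] : Prop :=
  ∃ n : ℕ, 0 < n ∧ ∀ (x y : S) (z : ℕ → WithOne S),
    (malcevSeq (x : WithOne S) (y : WithOne S) z n).1 =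
      (malcevSeq (x : WithOne S) (y : WithOne S) z n).2

theorem malcevSeq_map {M N : Type*} [Monoid M] [Monoid N] (F : M →* N) (x y : M) (z : ℕ → M)
    (n : ℕ) : malcevSeq (F x) (F y) (fun k => F (z k)) n =
      (F (malcevSeq x y z n).1, F (malcevSeq x y z n).2) := by
  induction n with
  | zero => rfl
  | succ n ih => simp [malcevSeq, ih]

theorem malcevSeq_eq_of_le {M : Type*} [Monoid M] (x y : M) (z : ℕ → M) {n m : ℕ} (h : n ≤ m)
    (e : (malcevSeq x y z n).1 = (malcevSeq x y z n).2) :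
    (malcevSeq x y z m).1 = (malcevSeq x y z m).2 := by
  induction m, h using Nat.le_induction with
  | base => exact e
  | succ m _ ih => simp [malcevSeq, ih]

theorem exists_coe_mul_mul {S : Type*} [Semigroup S] (x y : S) (w : WithOne S) :
    ∃ s : S, (x : WithOne S) * w * (y : WithOne S) = (s : WithOne S) := by
  induction w with
  | one => exact ⟨x * y, by simp⟩
  | coe a => exact ⟨x * a * y, by simp⟩

theorem exists_coe_mul_mul' {S : Type*} [Semigroup S] (u v : WithOne S) (x : S) :
    ∃ s : S, u * (x : WithOne S) * v = (s : WithOne S) := by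
  induction u with
  | one => induction v with
    | one => exact ⟨x, by simp⟩
    | coe b => exact ⟨x * b, by simp⟩
  | coe a => induction v with
    | one => exact ⟨a * x, by simp⟩
    | coe b => exact ⟨a * x * b, by simp⟩

theorem exists_coe_malcevSeq {S : Type*} [Semigroup S] (x y : S) (z : ℕ → WithOne S) (n : ℕ) :
    ∃ s t : S, malcevSeq (x : WithOne S) (y : WithOne S) z n =
      ((s : WithOne S), (t : WithOne S)) := by
  induction n with
  | zero => exact ⟨x, y, rfl⟩
  | succ n ih =>
    obtain ⟨s, t, h⟩ := ih
    obtain ⟨a, ha⟩ := exists_coe_mul_mul s t (z n)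
    obtain ⟨b, hb⟩ := exists_coe_mul_mul t s (z n)
    exact ⟨a, b, by simp [malcevSeq, h, ha, hb]⟩

theorem mapMulHom_surjective {S T : Type*} [Semigroup S] [Semigroup T] (f : S →ₙ* T)
    (hf : Function.Surjective f) : Function.Surjective (WithOne.mapMulHom f) := by
  intro t
  induction t with
  | one => exact ⟨1, map_one _⟩
  | coe t =>
    obtain ⟨s, rfl⟩ := hf t
    exact ⟨s, WithOne.mapMulHom_coe f s⟩

/-- The pseudovariety of finite semigroups that are nilpotent in the sense of Mal'cev. -/
def MN : Pseudovariety.{u} where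
  Mem S _ := Finite S ∧ Nonempty S ∧ IsMalcevNilpotent S
  finite _ _ h := h.1
  nonempty _ _ h := h.2.1
  sub S T _ _ f hT hf h := by
    obtain ⟨hfin, -, n, hn, h⟩ := h
    refine ⟨Finite.of_injective f hf, hT, n, hn, fun x y z => ?_⟩
    apply WithOne.mapMulHom_injective hf
    have := h (f x) (f y) (fun k => WithOne.mapMulHom f (z k))
    rw [← WithOne.mapMulHom_coe f x, ← WithOne.mapMulHom_coe f y, malcevSeq_map] at this
    exact this
  quot S T _ _ f hf h := by
    obtain ⟨hfin, hS, n, hn, h⟩ := h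
    refine ⟨Finite.of_surjective f hf, hS.map f, n, hn, fun x y z => ?_⟩
    obtain ⟨x, rfl⟩ := hf x
    obtain ⟨y, rfl⟩ := hf y
    choose w hw using fun k => mapMulHom_surjective f hf (z k)
    obtain rfl : (fun k => WithOne.mapMulHom f (w k)) = z := funext hw
    rw [← WithOne.mapMulHom_coe f x, ← WithOne.mapMulHom_coe f y, malcevSeq_map]
    exact congrArg (WithOne.mapMulHom f) (h x y w)
  pi ι _ S _ h := by
    have := fun i => (h i).1
    have := fun i => (h i).2.1
    choose n hn hN using fun i => (h i).2.2
    cases nonempty_fintype ι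
    refine ⟨inferInstance, inferInstance, (∑ i, n i) + 1, Nat.succ_pos _, fun x y z => ?_⟩
    obtain ⟨s, t, hst⟩ := exists_coe_malcevSeq x y z ((∑ i, n i) + 1)
    rw [hst]
    refine congrArg _ (funext fun i => ?_)
    have key := malcevSeq_map (WithOne.mapMulHom (Pi.evalMulHom S i)) x y z ((∑ i, n i) + 1)
    rw [hst] at key
    simp only [WithOne.mapMulHom_coe] at key
    have h2 := malcevSeq_eq_of_le _ _ _ (le_trans (Finset.single_le_sum (f := n)
      (fun _ _ => Nat.zero_le _) (Finset.mem_univ i)) (Nat.le_succ _))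
      (hN i (Pi.evalMulHom S i x) (Pi.evalMulHom S i y)
        (fun k => WithOne.mapMulHom (Pi.evalMulHom S i) (z k)))
    rw [key] at h2
    exact WithOne.coe_injective h2

/-! ### `𝒥`-trivial semigroups -/

/-- `x ∈ S¹ y S¹`. -/
def JLe {S : Type*} [Semigroup S] (x y : S) : Prop :=
  ∃ u v : WithOne S, (x : WithOne S) = u * (y : WithOne S) * v

/-- A semigroup is `𝒥`-trivial if `S¹ x S¹ = S¹ y S¹` implies `x = y`. -/
def IsJTrivial (S : Type*) [Semigroup S] : Prop :=
  ∀ x y : S, JLe x y → JLe y x → x = y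

theorem JLe.map {S T : Type*} [Semigroup S] [Semigroup T] (f : S →ₙ* T) {x y : S}
    (h : JLe x y) : JLe (f x) (f y) := by
  obtain ⟨u, v, h⟩ := h
  refine ⟨WithOne.mapMulHom f u, WithOne.mapMulHom f v, ?_⟩
  rw [← WithOne.mapMulHom_coe f x, ← WithOne.mapMulHom_coe f y, h, map_mul, map_mul]

theorem IsJTrivial.of_surjective {S T : Type*} [Semigroup S] [Semigroup T] [Finite S]
    (hS : IsJTrivial S) (f : S →ₙ* T) (hf : Function.Surjective f) : IsJTrivial T := by
  rintro x y ⟨u, v, hx⟩ ⟨u', v', hy⟩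
  obtain ⟨s, rfl⟩ := hf x
  obtain ⟨u, rfl⟩ := mapMulHom_surjective f hf u
  obtain ⟨v, rfl⟩ := mapMulHom_surjective f hf v
  obtain ⟨u', rfl⟩ := mapMulHom_surjective f hf u'
  obtain ⟨v', rfl⟩ := mapMulHom_surjective f hf v'
  choose α hα using exists_coe_mul_mul' u' v'
  choose β hβ using exists_coe_mul_mul' u v
  have fα : ∀ a, f a = f s → f (α a) = y := fun a ha => WithOne.coe_injective (by
    rw [hy, ← WithOne.mapMulHom_coe f, ← hα, map_mul, map_mul, WithOne.mapMulHom_coe, ha])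
  have fβ : ∀ a, f a = y → f (β a) = f s := fun a ha => WithOne.coe_injective (by
    rw [hx, ← WithOne.mapMulHom_coe f, ← hβ, map_mul, map_mul, WithOne.mapMulHom_coe, ha])
  have fit : ∀ n, f ((fun a => β (α a))^[n] s) = f s := by
    intro n
    induction n with
    | zero => rfl
    | succ n ih =>
      rw [Function.iterate_succ_apply']
      exact fβ _ (fα _ ih)
  have lt : ∀ a b : S, JLe a b → JLe (β (α a)) b := by
    rintro a b ⟨p, q, h⟩
    exact ⟨u * u' * p, q * v' * v, by rw [← hβ, ← hα, h]; simp only [mul_assoc]⟩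
  have lit : ∀ (a : S) (n : ℕ), JLe ((fun a => β (α a))^[n] a) a := by
    intro a n
    induction n with
    | zero => exact ⟨1, 1, by simp⟩
    | succ n ih =>
      rw [Function.iterate_succ_apply']
      exact lt _ _ ih
  obtain ⟨m, n, hmn, e⟩ : ∃ m n, m < n ∧
      (fun a => β (α a))^[m] s = (fun a => β (α a))^[n] s := by
    obtain ⟨m, n, hne, e⟩ := Finite.exists_ne_map_eq_of_infinite
      (fun n : ℕ => (fun a => β (α a))^[n] s)
    rcases lt_or_gt_of_ne hne with h | h
    · exact ⟨m, n, h, e⟩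
    · exact ⟨n, m, h, e.symm⟩
  have h1 : JLe (α ((fun a => β (α a))^[m] s)) ((fun a => β (α a))^[m] s) :=
    ⟨u', v', (hα _).symm⟩
  have h2 : JLe ((fun a => β (α a))^[m] s) (α ((fun a => β (α a))^[m] s)) := by
    obtain ⟨k, rfl⟩ := Nat.exists_eq_add_of_lt hmn
    have e2 : (fun a => β (α a))^[m + k + 1] s =
        (fun a => β (α a))^[k] (β (α ((fun a => β (α a))^[m] s))) := by
      rw [show m + k + 1 = k + (m + 1) by omega, Function.iterate_add_apply,
        Function.iterate_succ_apply' _ m]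
    obtain ⟨p, q, h⟩ := lit (β (α ((fun a => β (α a))^[m] s))) k
    rw [← e2, ← e, ← hβ] at h
    exact ⟨p * u, v * q, by rw [h]; simp only [mul_assoc]⟩
  rw [← fit m, hS _ _ h2 h1]
  exact fα _ (fit m)

/-- The pseudovariety of finite `𝒥`-trivial semigroups. -/
def J : Pseudovariety.{u} where
  Mem S _ := Finite S ∧ Nonempty S ∧ IsJTrivial S
  finite _ _ h := h.1
  nonempty _ _ h := h.2.1
  sub S T _ _ f hT hf h := by
    obtain ⟨hfin, -, h⟩ := h
    exact ⟨Finite.of_injective f hf, hT, fun x y h1 h2 => hf (h _ _ (h1.map f) (h2.map f))⟩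
  quot S T _ _ f hf h := by
    obtain ⟨hfin, hS, h⟩ := h
    exact ⟨Finite.of_surjective f hf, hS.map f, h.of_surjective f hf⟩
  pi ι _ S _ h := by
    have := fun i => (h i).1
    have := fun i => (h i).2.1
    exact ⟨inferInstance, inferInstance, fun x y h1 h2 => funext fun i =>
      (h i).2.2 _ _ (h1.map (Pi.evalMulHom S i)) (h2.map (Pi.evalMulHom S i))⟩

/-! ### Nilpotent groups -/

/-- The semigroup `S` is (the multiplicative semigroup of) a nilpotent group. -/
def IsNilpotentGroup (S : Type u) [Semigroup S] : Prop :=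
  ∃ (G : Type u) (_ : Group G), Group.IsNilpotent G ∧ Nonempty (S ≃* G)

theorem IsNilpotentGroup.nonempty {S : Type u} [Semigroup S] (h : IsNilpotentGroup S) :
    Nonempty S := by
  obtain ⟨G, _, -, ⟨e⟩⟩ := h
  exact ⟨e.symm 1⟩

theorem IsNilpotentGroup.of_surjective {S T : Type u} [Semigroup S] [Semigroup T]
    (hS : IsNilpotentGroup S) (f : S →ₙ* T) (hf : Function.Surjective f) :
    IsNilpotentGroup T := by
  obtain ⟨G, _, hG, ⟨e⟩⟩ := hS
  have hsurj : Function.Surjective fun g : G => f (e.symm g) := hf.comp e.symm.surjective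
  let : One T := ⟨f (e.symm 1)⟩
  let : Inv T := ⟨fun t => f (e.symm (Function.surjInv hsurj t)⁻¹)⟩
  let grp : Group T := Group.ofLeftAxioms mul_assoc
    (fun t => by
      obtain ⟨g, rfl⟩ := hsurj t
      change f (e.symm 1) * f (e.symm g) = f (e.symm g)
      rw [← map_mul, ← map_mul, one_mul])
    (fun t => by
      change f (e.symm (Function.surjInv hsurj t)⁻¹) * t = f (e.symm 1)
      have hs : f (e.symm (Function.surjInv hsurj t)) = t := Function.surjInv_eq hsurj t
      calc f (e.symm (Function.surjInv hsurj t)⁻¹) * t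
          = f (e.symm (Function.surjInv hsurj t)⁻¹) * f (e.symm (Function.surjInv hsurj t)) := by
            rw [hs]
        _ = f (e.symm 1) := by rw [← map_mul, ← map_mul, inv_mul_cancel])
  let F : G →* T := MonoidHom.mk' (fun g => f (e.symm g)) (fun a b => by
    rw [map_mul, map_mul])
  exact ⟨T, grp, Group.nilpotent_of_surjective F hsurj, ⟨⟨Equiv.refl T, fun _ _ => rfl⟩⟩⟩

theorem IsNilpotentGroup.of_injective {S T : Type u} [Semigroup S] [Semigroup T] [Finite S]
    (hS : IsNilpotentGroup S) (hT : Nonempty T) (f : T →ₙ* S) (hf : Function.Injective f) :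
    IsNilpotentGroup T := by
  obtain ⟨G, _, hG, ⟨e⟩⟩ := hS
  have : Finite G := Finite.of_equiv S e.toEquiv
  have hpow : ∀ (t : T) (n : ℕ), ∃ t', e (f t') = e (f t) ^ (n + 1) := by
    intro t n
    induction n with
    | zero => exact ⟨t, by simp⟩
    | succ n ih =>
      obtain ⟨t', h⟩ := ih
      exact ⟨t' * t, by rw [map_mul, map_mul, h, ← pow_succ]⟩
  have hinv : ∀ t : T, ∃ t', e (f t') = (e (f t))⁻¹ := by
    intro t
    obtain ⟨t', h⟩ := hpow t (2 * (orderOf (e (f t)) - 1))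
    refine ⟨t', h.trans (eq_inv_of_mul_eq_one_left ?_)⟩
    have := orderOf_pos (e (f t))
    rw [← pow_succ, show 2 * (orderOf (e (f t)) - 1) + 1 + 1 = orderOf (e (f t)) * 2 by omega,
      pow_mul, pow_orderOf_eq_one, one_pow]
  let H : Subgroup G :=
    { carrier := Set.range fun t => e (f t)
      mul_mem' := by
        rintro _ _ ⟨a, rfl⟩ ⟨b, rfl⟩
        exact ⟨a * b, by simp⟩
      one_mem' := by
        obtain ⟨t⟩ := hT
        obtain ⟨t', h⟩ := hinv t
        exact ⟨t * t', by simp [h]⟩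
      inv_mem' := by
        rintro _ ⟨a, rfl⟩
        exact hinv a }
  let F : T → H := fun t => ⟨e (f t), t, rfl⟩
  have hF : Function.Bijective F := by
    refine ⟨fun a b h => hf (e.injective (congrArg Subtype.val h)), ?_⟩
    rintro ⟨_, t, rfl⟩
    exact ⟨t, rfl⟩
  refine ⟨H, inferInstance, inferInstance, ⟨⟨Equiv.ofBijective F hF, fun a b => ?_⟩⟩⟩
  exact Subtype.ext (by simp [F])

/-- The pseudovariety of finite nilpotent groups. -/
def Gnil : Pseudovariety.{u} where
  Mem S _ := Finite S ∧ IsNilpotentGroup S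
  finite _ _ h := h.1
  nonempty _ _ h := h.2.nonempty
  sub S T _ _ f hT hf h := by
    have := h.1
    exact ⟨Finite.of_injective f hf, h.2.of_injective hT f hf⟩
  quot S T _ _ f hf h := by
    have := h.1
    exact ⟨Finite.of_surjective f hf, h.2.of_surjective f hf⟩
  pi ι _ S _ h := by
    have := fun i => (h i).1
    choose G hG hnil he using fun i => (h i).2
    exact ⟨inferInstance, ∀ i, G i, inferInstance, inferInstance,
      ⟨MulEquiv.piCongrRight fun i => (he i).some⟩⟩

/-! ### Mal'cev products -/

/-- A relational morphism `τ : S → T`, given by its graph: a subsemigroup of `S × T` that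
projects onto `S`. -/
structure RelMorphism (S T : Type*) [Semigroup S] [Semigroup T] where
  graph : Subsemigroup (S × T)
  total : ∀ s, ∃ t, (s, t) ∈ graph

/-- The subsemigroup `τ⁻¹(e)` of `S`, for an idempotent `e` of `T`. -/
def RelMorphism.preimage {S T : Type*} [Semigroup S] [Semigroup T] (τ : RelMorphism S T) (e : T)
    (he : IsIdempotentElem e) : Subsemigroup S where
  carrier := {s | (s, e) ∈ τ.graph}
  mul_mem' {a b} ha hb := by
    have := τ.graph.mul_mem ha hb
    rwa [Prod.mk_mul_mk, he.eq] at this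

/-- The Mal'cev product `V ⓜ W`: the finite semigroups `S` for which there is a relational
morphism `τ` from `S` to some `T ∈ W` such that `τ⁻¹(e) ∈ V` for every idempotent `e` of `T`
(in the image of `τ`, members of a pseudovariety being nonempty). -/
def malcevProduct (V W : Pseudovariety.{u}) : Pseudovariety.{u} where
  Mem S _ := Finite S ∧ Nonempty S ∧ ∃ (T : Type u) (_ : Semigroup T), W.Mem T ∧
    ∃ τ : RelMorphism S T, ∀ (e : T) (he : IsIdempotentElem e),
      Nonempty (τ.preimage e he) → V.Mem (τ.preimage e he)
  finite _ _ h := h.1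
  nonempty _ _ h := h.2.1
  sub S S' _ _ f hS' hf h := by
    obtain ⟨hfin, -, T, _, hT, τ, hτ⟩ := h
    refine ⟨Finite.of_injective f hf, hS', T, inferInstance, hT,
      ⟨τ.graph.comap (f.prodMap (MulHom.id T)), fun s => τ.total (f s)⟩, fun e he hne => ?_⟩
    obtain ⟨s, hs⟩ := hne
    refine V.sub (τ.preimage e he) _ ⟨fun a => ⟨f a.1, a.2⟩, fun a b => ?_⟩ ⟨s, hs⟩ ?_
      (hτ e he ⟨f s, hs⟩)
    · exact Subtype.ext (map_mul f a.1 b.1)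
    · exact fun a b h => Subtype.ext (hf (congrArg Subtype.val h))
  quot S S' _ _ f hf h := by
    obtain ⟨hfin, hS, T, _, hT, τ, hτ⟩ := h
    refine ⟨Finite.of_surjective f hf, hS.map f, T, inferInstance, hT,
      ⟨τ.graph.map (f.prodMap (MulHom.id T)), fun s' => ?_⟩, fun e he hne => ?_⟩
    · obtain ⟨s, rfl⟩ := hf s'
      obtain ⟨t, ht⟩ := τ.total s
      exact ⟨t, (s, t), ht, rfl⟩
    · have key : ∀ s', (s', e) ∈ τ.graph.map (f.prodMap (MulHom.id T)) ↔
          ∃ s, (s, e) ∈ τ.graph ∧ f s = s' := by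
        intro s'
        constructor
        · rintro ⟨⟨s, t⟩, hst, h⟩
          obtain ⟨rfl, rfl⟩ := Prod.mk.inj h
          exact ⟨s, hst, rfl⟩
        · rintro ⟨s, hs, rfl⟩
          exact ⟨(s, e), hs, rfl⟩
      obtain ⟨s', hs'⟩ := hne
      obtain ⟨s, hs, -⟩ := (key s').1 hs'
      refine V.quot (τ.preimage e he) _
        ⟨fun a => ⟨f a.1, (key _).2 ⟨a.1, a.2, rfl⟩⟩, fun a b => ?_⟩ ?_ (hτ e he ⟨s, hs⟩)
      · exact Subtype.ext (map_mul f a.1 b.1)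
      · rintro ⟨a', ha'⟩
        obtain ⟨a, ha, rfl⟩ := (key a').1 ha'
        exact ⟨⟨a, ha⟩, rfl⟩
  pi ι _ S _ h := by
    have := fun i => (h i).1
    have := fun i => (h i).2.1
    choose T hTs hT τ hτ using fun i => (h i).2.2
    refine ⟨inferInstance, inferInstance, ∀ i, T i, inferInstance, W.pi ι T hT,
      ⟨⟨{p | ∀ i, (p.1 i, p.2 i) ∈ (τ i).graph},
        fun ha hb i => (τ i).graph.mul_mem (ha i) (hb i)⟩, fun s => ?_⟩, fun e he hne => ?_⟩
    · choose t ht using fun i => (τ i).total (s i)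
      exact ⟨t, ht⟩
    · have he' : ∀ i, IsIdempotentElem (e i) := fun i => congrFun he i
      obtain ⟨s, hs⟩ := hne
      refine V.sub (∀ i, (τ i).preimage (e i) (he' i)) _
        ⟨fun a i => ⟨a.1 i, a.2 i⟩, fun a b => rfl⟩ ⟨s, hs⟩ ?_
        (V.pi ι _ fun i => hτ i (e i) (he' i) ⟨s i, hs i⟩)
      exact fun a b h => Subtype.ext (funext fun i => congrArg Subtype.val (congrFun h i))

/-! ### Semigroups of transformations -/

/-- The full transformation semigroup on `{1, …, n} ∪ {θ}`. The point `i` is `some (i - 1)` and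
`θ` is `none`. Transformations act on the right: in a product the left factor is applied first. -/
def Transf (n : ℕ) : Type := Option (Fin n) → Option (Fin n)

instance (n : ℕ) : Semigroup (Transf n) where
  mul f g := fun x => g (f x)
  mul_assoc _ _ _ := rfl

/-- The transformation fixing `θ` with the given values on `{1, …, n}`. -/
def Transf.ofFun {n : ℕ} (v : Fin n → Option (Fin n)) : Transf n
  | none => none
  | some i => v i

/-- The Rees matrix semigroup `ℳ⁰({1}, n, n; I_n)` as a set of transformations: the nonzero element
`(1; i, j)` sends `i` to `j` and all other points to `θ`; the zero sends all points to `θ`. -/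
def brandt (n : ℕ) : Set (Transf n) :=
  {f | f = Transf.ofFun (fun _ => none) ∨
    ∃ i j : Fin n, f = Transf.ofFun (fun k => if k = i then some j else none)}

/-- `f` fixes `θ` and is injective on the points that it does not send to `θ`. -/
def Transf.IsPartialInj {n : ℕ} (f : Transf n) : Prop :=
  f none = none ∧ ∀ i j k : Fin n, f (some i) = some k → f (some j) = some k → i = j

theorem Transf.mul_apply {n : ℕ} (f g : Transf n) (x : Option (Fin n)) : (f * g) x = g (f x) :=
  rfl

theorem Transf.IsPartialInj.mul {n : ℕ} {f g : Transf n} (hf : f.IsPartialInj)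
    (hg : g.IsPartialInj) : (f * g).IsPartialInj := by
  refine ⟨by rw [mul_apply, hf.1, hg.1], fun i j k hi hj => ?_⟩
  rw [mul_apply] at hi hj
  cases hi' : f (some i) with
  | none => simp [hi', hg.1] at hi
  | some a =>
    cases hj' : f (some j) with
    | none => simp [hj', hg.1] at hj
    | some b =>
      rw [hi'] at hi
      rw [hj'] at hj
      obtain rfl := hg.2 a b k hi hj
      exact hf.2 i j a hi' hj'

theorem Transf.isPartialInj_of_mem_brandt {n : ℕ} {f : Transf n} (hf : f ∈ brandt n) :
    f.IsPartialInj := by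
  rcases hf with rfl | ⟨a, b, rfl⟩
  · exact ⟨rfl, fun _ _ _ hi => by simp [ofFun] at hi⟩
  · refine ⟨rfl, fun i j k hi hj => ?_⟩
    simp only [ofFun, Option.ite_none_right_eq_some] at hi hj
    rw [hi.1, hj.1]

theorem brandt_mul_mem {n : ℕ} {f g : Transf n} (hf : f ∈ brandt n) (hg : g.IsPartialInj) :
    f * g ∈ brandt n := by
  rcases hf with rfl | ⟨a, b, rfl⟩
  · left
    funext x
    cases x <;> exact hg.1
  · cases hb : g (some b) with
    | none =>
      left
      funext x
      cases x with
      | none => exact hg.1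
      | some i => by_cases h : i = a <;> simp [Transf.mul_apply, Transf.ofFun, h, hb, hg.1]
    | some c =>
      right
      refine ⟨a, c, ?_⟩
      funext x
      cases x with
      | none => exact hg.1
      | some i => by_cases h : i = a <;> simp [Transf.mul_apply, Transf.ofFun, h, hb, hg.1]

theorem mul_brandt_mem {n : ℕ} {f g : Transf n} (hf : f.IsPartialInj) (hg : g ∈ brandt n) :
    f * g ∈ brandt n := by
  rcases hg with rfl | ⟨a, b, rfl⟩
  · left
    funext x
    cases x with
    | none => simp [Transf.mul_apply, Transf.ofFun, hf.1]
    | some i => cases h : f (some i) <;> simp [Transf.mul_apply, Transf.ofFun, h]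
  · by_cases hex : ∃ i, f (some i) = some a
    · obtain ⟨i, hi⟩ := hex
      right
      refine ⟨i, b, ?_⟩
      funext x
      cases x with
      | none => simp [Transf.mul_apply, Transf.ofFun, hf.1]
      | some j =>
        by_cases hj : j = i
        · simp [Transf.mul_apply, Transf.ofFun, hj, hi]
        · cases h : f (some j) with
          | none => simp [Transf.mul_apply, Transf.ofFun, h, hj]
          | some c =>
            have : c ≠ a := fun hc => hj (hf.2 j i a (hc ▸ h) hi)
            simp [Transf.mul_apply, Transf.ofFun, h, hj, this]
    · left
      push Not at hex
      funext x
      cases x with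
      | none => simp [Transf.mul_apply, Transf.ofFun, hf.1]
      | some j =>
        cases h : f (some j) with
        | none => simp [Transf.mul_apply, Transf.ofFun, h]
        | some c =>
          have : c ≠ a := fun hc => hex j (hc ▸ h)
          simp [Transf.mul_apply, Transf.ofFun, h, this]

/-- The identity transformation. -/
def Transf.id (n : ℕ) : Transf n := fun x => x

/-- The subsemigroup `ℳ⁰({1}, n, n; I_n) ∪ A` of the full transformation semigroup, for a set `A`
of partial injections for which this union is closed under multiplication. -/
def brandtUnion {n : ℕ} (A : Set (Transf n)) (hA : ∀ f ∈ A, f.IsPartialInj)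
    (hmul : ∀ f ∈ A, ∀ g ∈ A, f * g ∈ brandt n ∪ A) : Subsemigroup (Transf n) where
  carrier := brandt n ∪ A
  mul_mem' := by
    rintro f g (hf | hf) (hg | hg)
    · exact Or.inl (brandt_mul_mem hf (Transf.isPartialInj_of_mem_brandt hg))
    · exact Or.inl (brandt_mul_mem hf (hA g hg))
    · exact Or.inl (mul_brandt_mem (hA f hf) hg)
    · exact hmul f hf g hg

/-- `a₂ = (1, 2, …, 15)`, with `16 ↦ θ`. -/
def a₂ : Transf 16 :=
  Transf.ofFun fun i => if i = 15 then none else if i = 14 then some 0 else some (i + 1)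

/-- `b₂ = (16, 1, 2, …, 15, θ)`; addition in `Fin 16` is cyclic. -/
def b₂ : Transf 16 :=
  Transf.ofFun fun i => if i = 14 then none else some (i + 1)

theorem isPartialInj_closure (f : Transf 16) (hf : f ∈ Subsemigroup.closure {a₂, b₂}) :
    f.IsPartialInj := by
  induction hf using Subsemigroup.closure_induction with
  | mem f hf =>
    rcases hf with rfl | rfl
    · exact ⟨rfl, by simp only [a₂, Transf.ofFun]; decide⟩
    · exact ⟨rfl, by simp only [b₂, Transf.ofFun]; decide⟩
  | mul f g _ _ hf hg => exact hf.mul hg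

theorem Transf.isPartialInj_id (n : ℕ) : (Transf.id n).IsPartialInj :=
  ⟨rfl, fun _ _ _ hi hj => Option.some_injective _ (Eq.trans hi (Eq.symm hj))⟩

/-- `N₂ = ℳ⁰({1}, 16, 16; I₁₆) ∪ ⟨a₂, b₂⟩ ∪ {1}`. -/
def N₂ : Subsemigroup (Transf 16) :=
  brandtUnion ((Subsemigroup.closure {a₂, b₂} : Set (Transf 16)) ∪ {Transf.id 16})
    (by
      rintro f (hf | rfl)
      · exact isPartialInj_closure f hf
      · exact Transf.isPartialInj_id 16)
    (by
      rintro f (hf | rfl) g (hg | rfl)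
      · exact Or.inr (Or.inl (mul_mem hf hg))
      · exact Or.inr (Or.inl hf)
      · exact Or.inr (Or.inl hg)
      · exact Or.inr (Or.inr rfl))

/-- `c₃ = (1, 2, θ)(3, 4, θ)`. -/
def c₃ : Transf 4 := Transf.ofFun ![some 1, none, some 3, none]

/-- `d₃ = (1, 4, θ)(3, 2, θ)`. -/
def d₃ : Transf 4 := Transf.ofFun ![some 3, none, some 1, none]

/-- `M₃ = ℳ⁰({1}, 4, 4; I₄) ∪ {c₃, d₃, 1}`. -/
def M₃ : Subsemigroup (Transf 4) :=
  brandtUnion {c₃, d₃, Transf.id 4}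
    (by
      rintro f (rfl | rfl | rfl)
      · exact ⟨rfl, by simp only [c₃, Transf.ofFun]; decide⟩
      · exact ⟨rfl, by simp only [d₃, Transf.ofFun]; decide⟩
      · exact Transf.isPartialInj_id 4)
    (by
      have h : ∀ f g : Transf 4, (∀ x, g (f x) = none) → f * g ∈ brandt 4 := fun f g h =>
        Or.inl (funext fun x => (h x).trans (by cases x <;> rfl))
      rintro f (rfl | rfl | rfl) g (rfl | rfl | rfl)
      · exact Or.inl (h _ _ (by decide))
      · exact Or.inl (h _ _ (by decide))
      · exact Or.inr (Or.inl rfl)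
      · exact Or.inl (h _ _ (by decide))
      · exact Or.inl (h _ _ (by decide))
      · exact Or.inr (Or.inr (Or.inl rfl))
      · exact Or.inr (Or.inl rfl)
      · exact Or.inr (Or.inr (Or.inl rfl))
      · exact Or.inr (Or.inr (Or.inr rfl)))

end FinSemigroup

/-!
`N₂` is Mal'cev nilpotent because all its elements act as shifts. Place the points `1, …, 16` in
`ℤ/15`, so that `15` and `16` coincide; every element of `N₂` then moves all the points of its
domain by one and the same amount, and every element other than `1` meets each fiber of the
placement at most once, in its domain and in its image (`isNarrow_of_mem_N₂`). For words
`λ, ρ` of equal shift, the domains can only shrink when passing to `λ z ρ` and `ρ z λ`. If they do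
not, then a translation of `ℤ/15` exchanges the projections of the two domains; as `15` is odd, these
projections agree, and then the words do (`mul_mul_eq_of_dom_subset`). The two domains can shrink
only boundedly often, so that `λ_n = ρ_n` for large `n` (`isMalcevNilpotent_of_isNarrow`).

`N₂` is not in the Mal'cev product because finite nilpotent groups cannot separate the points `15`
and `16`. Let a relational morphism to such a group `G` relate `a₂` to `g` and `b₂` to `h`. The group
elements related to `(1; 15, 15)` form a subgroup `K`, which contains `g ^ 15` and the conjugates of
`u = h g⁻¹` by `g ^ i` for `1 ≤ i ≤ 14`. Since elements of coprime orders commute in `G`, the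
conjugates for `i = 3` and `i = 5` suffice to conclude that `u ∈ K` (`mem_of_conj_mem`). But `u` is
also related to `(1; 16, 15)`. Hence `1` is related to both `(1; 16, 15)` and `(1; 15, 15)`, which
are distinct and `𝒥`-equivalent in the preimage of `1` (`N₂_not_mem_malcevProduct`).

`M₃` is in the Mal'cev product because its elements act as shifts on `ℤ/4`, and those of shift `0`
are partial identities (`M₃_mem_malcevProduct`). It is not Mal'cev nilpotent: with `c₃` and `d₃` as
alternating parameters, two units of `B₄` produce a periodic sequence of pairs of distinct elements
(`M₃_not_mem_MN`).
-/

namespace FinSemigroup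

/-! ### Shifts of partial maps -/

/-- `f` translates every point that it does not send to `θ` by `s`, where the points `1, …, n` are
placed in `ℤ/m` by `π`. The zero transformation has every shift. (The point `i` is `i - 1` in
`Fin n`.) -/
def HasShift {n m : ℕ} (π : Fin n → ZMod m) (f : Transf n) (s : ZMod m) : Prop :=
  ∀ i j, f (some i) = some j → π j = π i + s

theorem HasShift.mul {n m : ℕ} {π : Fin n → ZMod m} {f g : Transf n} {s t : ZMod m}
    (hf : HasShift π f s) (hg : HasShift π g t) (hg0 : g none = none) :
    HasShift π (f * g) (s + t) := by
  intro i k h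
  rw [Transf.mul_apply] at h
  cases hj : f (some i) with
  | none => simp [hj, hg0] at h
  | some j =>
    rw [hj] at h
    rw [hg j k h, hf i j hj, add_assoc]

theorem hasShift_id {n m : ℕ} (π : Fin n → ZMod m) : HasShift π (Transf.id n) 0 := by
  intro i j h
  rw [add_zero, Option.some_injective _ (show some i = some j from h)]

/-- The nonzero element `(1; i, j)` of `brandt n`. -/
def Transf.unit {n : ℕ} (i j : Fin n) : Transf n :=
  Transf.ofFun (fun k => if k = i then some j else none)

theorem Transf.unit_mem {n : ℕ} (i j : Fin n) : Transf.unit i j ∈ brandt n := Or.inr ⟨i, j, rfl⟩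

theorem Transf.unit_apply_eq_some {n : ℕ} {i j k l : Fin n} :
    Transf.unit i j (some k) = some l ↔ k = i ∧ j = l := by
  simp [Transf.unit, Transf.ofFun]

/-- Right multiplication by a transformation that maps `j` to `k`. -/
theorem Transf.unit_mul {n : ℕ} {i j k : Fin n} {f : Transf n} (h0 : f none = none)
    (h : f (some j) = some k) : Transf.unit i j * f = Transf.unit i k := by
  funext x
  cases x with
  | none => exact h0
  | some l => by_cases hl : l = i <;> simp [Transf.mul_apply, unit, ofFun, hl, h, h0]

theorem Transf.unit_mul_unit {n : ℕ} (i j k : Fin n) :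
    Transf.unit i j * Transf.unit j k = Transf.unit i k :=
  Transf.unit_mul rfl (Transf.unit_apply_eq_some.2 ⟨rfl, rfl⟩)

theorem Transf.unit_injective {n : ℕ} {i j k l : Fin n} (h : Transf.unit i j = Transf.unit k l) :
    i = k ∧ j = l := by
  have := congrFun h (some i)
  rw [Transf.unit_apply_eq_some.2 ⟨rfl, rfl⟩] at this
  obtain ⟨h1, h2⟩ := Transf.unit_apply_eq_some.1 this.symm
  exact ⟨h1, h2.symm⟩

theorem hasShift_unit {n m : ℕ} (π : Fin n → ZMod m) (i j : Fin n) :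
    HasShift π (Transf.unit i j) (π j - π i) := by
  intro k l h
  obtain ⟨rfl, rfl⟩ := Transf.unit_apply_eq_some.1 h
  ring

theorem hasShift_zero {n m : ℕ} (π : Fin n → ZMod m) (s : ZMod m) :
    HasShift π (Transf.ofFun fun _ => none) s := by
  intro i j h
  simp [Transf.ofFun] at h

theorem exists_hasShift_of_mem_brandt {n m : ℕ} (π : Fin n → ZMod m) {f : Transf n}
    (hf : f ∈ brandt n) : ∃ s, HasShift π f s := by
  rcases hf with rfl | ⟨i, j, rfl⟩
  · exact ⟨0, hasShift_zero π 0⟩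
  · exact ⟨_, hasShift_unit π i j⟩

/-! ### The monoid of transformations -/

instance Transf.instMonoid (n : ℕ) : Monoid (Transf n) where
  one := Transf.id n
  one_mul _ := rfl
  mul_one _ := rfl

theorem Transf.one_def (n : ℕ) : (1 : Transf n) = Transf.id n := rfl

/-- For a monoid `S` of transformations, parameters in `S¹` may be replaced by elements of `S`. -/
theorem isMalcevNilpotent_iff {n : ℕ} {S : Subsemigroup (Transf n)} (hS : 1 ∈ S) :
    IsMalcevNilpotent S ↔ ∃ k : ℕ, 0 < k ∧ ∀ x ∈ S, ∀ y ∈ S, ∀ z : ℕ → Transf n,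
      (∀ i, z i ∈ S) → (malcevSeq x y z k).1 = (malcevSeq x y z k).2 := by
  let F : WithOne S →* Transf n := WithOne.lift (MulMemClass.subtype S)
  have hF : ∀ x : S, F (x : WithOne S) = x := fun x => WithOne.lift_coe _ x
  refine exists_congr fun k => and_congr_right fun _ => ⟨fun h x hx y hy z hz => ?_,
    fun h x y z => ?_⟩
  · have := congrArg F (h ⟨x, hx⟩ ⟨y, hy⟩ fun i => ((⟨z i, hz i⟩ : S) : WithOne S))
    have key := malcevSeq_map F ((⟨x, hx⟩ : S) : WithOne S) ((⟨y, hy⟩ : S) : WithOne S)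
      (fun i => ((⟨z i, hz i⟩ : S) : WithOne S)) k
    simp only [hF] at key
    rw [key]
    exact this
  · have hz : ∀ i, F (z i) ∈ S := by
      intro i
      induction z i with
      | one => rwa [map_one]
      | coe a => rw [hF]; exact a.2
    have := h x x.2 y y.2 (fun i => F (z i)) hz
    rw [← hF x, ← hF y, malcevSeq_map] at this
    obtain ⟨s, t, hst⟩ := exists_coe_malcevSeq x y z k
    rw [hst] at this ⊢
    simp only [hF] at this
    exact congrArg _ (Subtype.ext this)

/-! ### The semigroup `M₃` -/

theorem M₃_not_mem_MN : ¬ MN.{0}.Mem M₃ := by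
  rintro ⟨-, -, h⟩
  obtain ⟨k, -, h⟩ := (isMalcevNilpotent_iff (S := M₃) (by right; simp [Transf.one_def])).1 h
  -- `1 → 2` and `3 → 4` under `c₃`, and `3 → 2` and `1 → 4` under `d₃`: with `x = (4, 1)`,
  -- `y = (2, 3)` and parameters `c₃, d₃, c₃, …` the pair of words is periodic of period two.
  let z : ℕ → Transf 4 := fun i => if Even i then c₃ else d₃
  have hz : ∀ i, z i ∈ M₃ := by
    intro i
    right
    by_cases hi : Even i <;> simp [z, hi]
  have key : ∀ i, malcevSeq (Transf.unit 3 0) (Transf.unit 1 2) z i =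
      if Even i then (Transf.unit 3 0, Transf.unit 1 2)
      else (Transf.unit 3 2, Transf.unit 1 0) := by
    intro i
    induction i with
    | zero => rfl
    | succ i ih =>
      rw [malcevSeq, ih]
      by_cases hi : Even i
      · simp only [hi, Nat.even_add_one, not_true, if_true, if_false, z]
        rw [Transf.unit_mul (f := c₃) (k := 1) rfl rfl, Transf.unit_mul (f := c₃) (k := 3) rfl rfl,
          Transf.unit_mul_unit, Transf.unit_mul_unit]
      · simp only [hi, Nat.even_add_one, not_false_eq_true, if_true, if_false, z]
        rw [Transf.unit_mul (f := d₃) (k := 1) rfl rfl, Transf.unit_mul (f := d₃) (k := 3) rfl rfl,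
          Transf.unit_mul_unit, Transf.unit_mul_unit]
  have := h _ (Or.inl (Transf.unit_mem 3 0)) _ (Or.inl (Transf.unit_mem 1 2)) z hz
  rw [key] at this
  split_ifs at this
  · exact absurd (Transf.unit_injective this).1 (by decide)
  · exact absurd (Transf.unit_injective this).1 (by decide)

instance Transf.instFinite (n : ℕ) : Finite (Transf n) :=
  inferInstanceAs (Finite (Option (Fin n) → Option (Fin n)))

theorem apply_none_of_mem_M₃ {f : Transf 4} (hf : f ∈ M₃) : f none = none := by
  rcases hf with hf | rfl | rfl | rfl
  · exact (Transf.isPartialInj_of_mem_brandt hf).1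
  all_goals rfl

/-- `f` is the identity on the set of points that it does not send to `θ`. -/
def IsPartialId {n : ℕ} (f : Transf n) : Prop :=
  f none = none ∧ ∀ i j, f (some i) = some j → j = i

theorem map_eq_of_jLe_of_jLe {n : ℕ} {S : Type*} [Semigroup S] (φ : S →ₙ* Transf n)
    (hφ : ∀ a, IsPartialId (φ a)) {x y : S} (hxy : JLe x y) (hyx : JLe y x) : φ x = φ y := by
  let F : WithOne S →* Transf n := WithOne.lift φ
  have hF : ∀ w, IsPartialId (F w) := by
    intro w
    induction w with
    | one =>
      rw [map_one]
      exact ⟨rfl, fun i j h => (Option.some_injective _ (show some i = some j from h)).symm⟩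
    | coe a => exact hφ a
  have le : ∀ {x y : S}, JLe x y → ∀ i j, φ x (some i) = some j → φ y (some i) = some j := by
    rintro x y ⟨u, v, h⟩ i j hij
    have hx : φ x = F u * φ y * F v := by
      have := congrArg F h
      rwa [map_mul, map_mul] at this
    obtain rfl := (hφ x).2 i j hij
    rw [hx, Transf.mul_apply, Transf.mul_apply] at hij
    cases hu : F u (some j) with
    | none => rw [hu, (hφ y).1, (hF v).1] at hij; cases hij
    | some a =>
      obtain rfl := (hF u).2 j a hu
      rw [hu] at hij
      cases hy : φ y (some a) with
      | none => rw [hy, (hF v).1] at hij; cases hij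
      | some b => rw [(hφ y).2 a b hy]
  funext p
  cases p with
  | none => rw [(hφ x).1, (hφ y).1]
  | some i => exact Option.ext fun j => ⟨le hxy i j, le hyx i j⟩

/-- The place in `ℤ/4` of a point of `{1, 2, 3, 4}`: both `c₃` and `d₃` become shifts. -/
def place₄ (i : Fin 4) : ZMod 4 := (i : ℕ)

theorem place₄_injective : Function.Injective place₄ := by decide

theorem exists_hasShift_of_mem_M₃ {f : Transf 4} (hf : f ∈ M₃) : ∃ s, HasShift place₄ f s := by
  rcases hf with hf | rfl | rfl | rfl
  · exact exists_hasShift_of_mem_brandt _ hf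
  · exact ⟨1, by simp only [HasShift, c₃, Transf.ofFun]; decide⟩
  · exact ⟨3, by simp only [HasShift, d₃, Transf.ofFun]; decide⟩
  · exact ⟨0, hasShift_id _⟩

/-- The relational morphism from `M₃` to `ℤ/4` that relates an element to its shifts. -/
def shiftMorphism : RelMorphism M₃ (Multiplicative (ZMod 4)) where
  graph :=
    { carrier := {p | HasShift place₄ p.1.1 p.2.toAdd}
      mul_mem' := fun {_ b} ha hb => HasShift.mul ha hb (apply_none_of_mem_M₃ b.1.2) }
  total s := by
    obtain ⟨t, ht⟩ := exists_hasShift_of_mem_M₃ s.2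
    exact ⟨Multiplicative.ofAdd t, ht⟩

/-- The elements of `M₃` of shift `0` are partial identities, so they form a semilattice. -/
theorem M₃_mem_malcevProduct : (malcevProduct J.{0} Gnil.{0}).Mem M₃ := by
  have h1 : (1 : Transf 4) ∈ M₃ := by right; simp [Transf.one_def]
  refine ⟨inferInstance, ⟨⟨1, h1⟩⟩, Multiplicative (ZMod 4), inferInstance,
    ⟨inferInstance, Multiplicative (ZMod 4), inferInstance, inferInstance, ⟨MulEquiv.refl _⟩⟩,
    shiftMorphism, fun e he hne => ⟨inferInstance, hne, fun x y hxy hyx => ?_⟩⟩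
  obtain rfl : e = 1 := IsIdempotentElem.iff_eq_one.1 he
  have fix : ∀ a : shiftMorphism.preimage 1 he, IsPartialId a.1.1 := fun a =>
    ⟨apply_none_of_mem_M₃ a.1.2, fun i j h =>
      place₄_injective (by rw [(show HasShift place₄ a.1.1 0 from a.2) i j h, add_zero])⟩
  let φ : shiftMorphism.preimage 1 he →ₙ* Transf 4 := ⟨fun a => a.1.1, fun _ _ => rfl⟩
  exact Subtype.ext (Subtype.ext (map_eq_of_jLe_of_jLe φ fix hxy hyx))

/-! ### Coprime elements of nilpotent groups -/

/-- In a nilpotent group, elements whose orders divide coprime numbers commute. -/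
theorem commute_of_pow_eq_one_of_coprime {G : Type*} [Group G] [Group.IsNilpotent G]
    {k l : ℕ} (hkl : k.Coprime l) : ∀ {x y : G}, x ^ k = 1 → y ^ l = 1 → Commute x y := by
  refine Group.nilpotent_center_quotient_ind
    (P := fun G _ _ => ∀ {x y : G}, x ^ k = 1 → y ^ l = 1 → Commute x y) G ?_ ?_
  · intro G _ _ x y _ _
    exact Subsingleton.elim _ _
  · intro G _ _ ih x y hx hy
    -- modulo the center `x` and `y` commute, so that their commutator `c` is central
    have hc : x * y * x⁻¹ * y⁻¹ ∈ Subgroup.center G := by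
      rw [← QuotientGroup.eq_one_iff]
      have := @ih (x : G ⧸ Subgroup.center G) (y : G ⧸ Subgroup.center G)
        (by rw [← QuotientGroup.mk_pow, hx]; rfl) (by rw [← QuotientGroup.mk_pow, hy]; rfl)
      simp only [QuotientGroup.mk_mul, QuotientGroup.mk_inv]
      rw [this.eq]
      group
    set c := x * y * x⁻¹ * y⁻¹ with hcdef
    have hcy : Commute c y := (Subgroup.mem_center_iff.1 hc y).symm
    have hcx : Commute c x⁻¹ := (Subgroup.mem_center_iff.1 hc x⁻¹).symm
    have h1 : c ^ l = 1 := by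
      have : x * y * x⁻¹ = c * y := by rw [hcdef]; group
      have := congrArg (· ^ l) this
      simpa [conj_pow, hy, hcy.mul_pow] using this.symm
    have h2 : c ^ k = 1 := by
      have : y * x⁻¹ * y⁻¹ = c * x⁻¹ := by
        rw [hcx.eq, hcdef]; group
      have := congrArg (· ^ k) this
      simpa [conj_pow, hx, hcx.mul_pow] using this.symm
    have h3 : c = 1 := by
      have := Nat.dvd_gcd (orderOf_dvd_of_pow_eq_one h2) (orderOf_dvd_of_pow_eq_one h1)
      rw [hkl, Nat.dvd_one, orderOf_eq_one_iff] at this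
      exact this
    rw [hcdef] at h3
    exact (mul_inv_eq_iff_eq_mul.1 (by rwa [mul_inv_eq_one] at h3))

/-- Conjugation by `g ^ e` acts on `u ^ b` as conjugation by `g ^ (e * b)`, which is in `K`. -/
theorem zpow_mem_of_conj_mem {G : Type*} [Group G] (K : Subgroup G) {g u : G} {a b : ℤ}
    (hab : a + b = 1) (e : ℤ) (hg : g ^ (e * b) ∈ K) (hu : g ^ e * u * (g ^ e)⁻¹ ∈ K)
    (hc : Commute (g ^ a) (u ^ b)) : u ^ b ∈ K := by
  have h1 : g ^ e * u ^ b * (g ^ e)⁻¹ ∈ K := by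
    rw [← conj_zpow]
    exact K.zpow_mem hu b
  have h2 : g ^ e = g ^ (e * b) * (g ^ a) ^ e := by
    rw [← zpow_mul, ← zpow_add]
    congr 1
    linear_combination (-e) * hab
  have h3 : g ^ e * u ^ b * (g ^ e)⁻¹ = g ^ (e * b) * u ^ b * (g ^ (e * b))⁻¹ := by
    rw [h2, mul_inv_rev, mul_assoc _ _ (u ^ b), (hc.zpow_left e).eq]
    group
  rw [h3, K.mul_mem_cancel_right (K.inv_mem hg), K.mul_mem_cancel_left hg] at h1
  exact h1

/-- If `K` contains `g ^ 15` and the conjugates of `u` by `g ^ 3` and `g ^ 5`, it contains `u`.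
The `3`-part of `u` commutes with the `3'`-part of `g`, while the third power of the `3`-part
of `g` lies in `K`; so conjugation by `g ^ 3` shows that `K` contains the `3`-part of `u`.
Conjugation by `g ^ 5` treats the `3'`-part of `u` in the same way. -/
theorem mem_of_conj_mem {G : Type*} [Group G] [Finite G] [Group.IsNilpotent G]
    (K : Subgroup G) {g u : G} (hg : g ^ 15 ∈ K) (h3 : g ^ 3 * u * (g ^ 3)⁻¹ ∈ K)
    (h5 : g ^ 5 * u * (g ^ 5)⁻¹ ∈ K) : u ∈ K := by
  obtain ⟨r, m, hm, hN⟩ := Nat.exists_eq_pow_mul_and_not_dvd (Nat.card_pos (α := G)).ne' 3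
    (by norm_num)
  have hcop : (3 ^ (r + 1)).Coprime (5 * m) := by
    apply Nat.Coprime.pow_left
    rw [Nat.coprime_mul_iff_right]
    exact ⟨by norm_num, (Nat.Prime.coprime_iff_not_dvd Nat.prime_three).2 hm⟩
  have hpow : ∀ x : G, x ^ (3 ^ (r + 1) * (5 * m)) = 1 := fun x => by
    rw [show 3 ^ (r + 1) * (5 * m) = Nat.card G * 15 by rw [hN]; ring, pow_mul, pow_card_eq_one',
      one_pow]
  -- Bézout coefficients of the `3`-part and the `3'`-part; the additional factors `3` and `5`
  -- make the powers of `g` below powers of `g ^ 15`.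
  have hbez := Nat.gcd_eq_gcd_ab (3 ^ (r + 1)) (5 * m)
  rw [hcop] at hbez
  set s := Nat.gcdA (3 ^ (r + 1)) (5 * m)
  set t := Nat.gcdB (3 ^ (r + 1)) (5 * m)
  push_cast at hbez
  have hA : ∀ x : G, (x ^ (3 ^ (r + 1) * s : ℤ)) ^ (5 * m) = 1 := fun x => by
    rw [← zpow_natCast, ← zpow_mul, show (3 ^ (r + 1) * s : ℤ) * ((5 * m : ℕ) : ℤ) =
      ((3 ^ (r + 1) * (5 * m) : ℕ) : ℤ) * s by push_cast; ring, zpow_mul, zpow_natCast, hpow,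
      one_zpow]
  have hB : ∀ x : G, (x ^ (5 * m * t : ℤ)) ^ (3 ^ (r + 1)) = 1 := fun x => by
    rw [← zpow_natCast, ← zpow_mul, show (5 * m * t : ℤ) * ((3 ^ (r + 1) : ℕ) : ℤ) =
      ((3 ^ (r + 1) * (5 * m) : ℕ) : ℤ) * t by push_cast; ring, zpow_mul, zpow_natCast, hpow,
      one_zpow]
  have hgz : ∀ k : ℤ, g ^ (15 * k) ∈ K := fun k => by
    rw [zpow_mul]
    exact K.zpow_mem (by exact_mod_cast hg) k
  have h1 : u ^ (5 * m * t : ℤ) ∈ K := by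
    refine zpow_mem_of_conj_mem K hbez.symm 3 ?_ (by exact_mod_cast h3)
      (commute_of_pow_eq_one_of_coprime hcop.symm (hA g) (hB u))
    rw [show 3 * (5 * m * t : ℤ) = 15 * (m * t) by ring]
    exact hgz _
  have h2 : u ^ (3 ^ (r + 1) * s : ℤ) ∈ K := by
    refine zpow_mem_of_conj_mem K ((add_comm _ _).trans hbez.symm) 5 ?_ (by exact_mod_cast h5)
      (commute_of_pow_eq_one_of_coprime hcop (hB g) (hA u))
    rw [show 5 * (3 ^ (r + 1) * s : ℤ) = 15 * (3 ^ r * s) by ring]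
    exact hgz _
  rw [← zpow_one u]
  have := K.mul_mem h2 h1
  rw [← zpow_add] at this
  simpa [← hbez] using this

/-! ### The semigroup `N₂` and relational morphisms to nilpotent groups -/

theorem a₂_mem_N₂ : a₂ ∈ N₂ := Or.inr (Or.inl (Subsemigroup.subset_closure (Or.inl rfl)))

theorem b₂_mem_N₂ : b₂ ∈ N₂ := Or.inr (Or.inl (Subsemigroup.subset_closure (Or.inr rfl)))

/-- The elements of a finite group that a multiplicative relation `R` (the graph of a relational
morphism) attaches to the units `(1; i, j)` form a groupoid: this lemma gives its identities,
`label_inv` its inverses. -/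
theorem label_one {n : ℕ} {G : Type*} [Group G] [Finite G] {R : Transf n → G → Prop}
    (hmul : ∀ {f g x y}, R f x → R g y → R (f * g) (x * y))
    (htot : ∀ i j, ∃ x, R (Transf.unit i j) x) (i : Fin n) : R (Transf.unit i i) 1 := by
  obtain ⟨x, hx⟩ := htot i i
  have : ∀ k : ℕ, R (Transf.unit i i) (x ^ (k + 1)) := by
    intro k
    induction k with
    | zero => simpa using hx
    | succ k ih =>
      have := hmul ih hx
      rwa [Transf.unit_mul_unit, ← pow_succ] at this
  have h := this (orderOf x - 1)
  rwa [Nat.sub_add_cancel (orderOf_pos x), pow_orderOf_eq_one] at h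

theorem label_inv {n : ℕ} {G : Type*} [Group G] [Finite G] {R : Transf n → G → Prop}
    (hmul : ∀ {f g x y}, R f x → R g y → R (f * g) (x * y))
    (htot : ∀ i j, ∃ x, R (Transf.unit i j) x) {i j : Fin n} {x : G}
    (hx : R (Transf.unit i j) x) : R (Transf.unit j i) x⁻¹ := by
  obtain ⟨y, hy⟩ := htot j i
  have hxy := hmul hx hy
  rw [Transf.unit_mul_unit] at hxy
  have : ∀ k : ℕ, R (Transf.unit i i) ((x * y) ^ k) := by
    intro k
    induction k with
    | zero => rw [pow_zero]; exact label_one hmul htot i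
    | succ k ih =>
      have := hmul ih hxy
      rwa [Transf.unit_mul_unit, ← pow_succ] at this
  -- `x⁻¹ = y (x y)⁻¹`, and `(x y)⁻¹` is a power of `x y`
  have h := hmul hy (this (orderOf (x * y) - 1))
  rw [Transf.unit_mul_unit] at h
  have hinv : (x * y) ^ (orderOf (x * y) - 1) = (x * y)⁻¹ := by
    apply eq_inv_of_mul_eq_one_left
    rw [← pow_succ, Nat.sub_add_cancel (orderOf_pos _), pow_orderOf_eq_one]
  rwa [hinv, mul_inv_rev, mul_inv_cancel_left] at h

/-- A relational morphism to a finite nilpotent group cannot tell the points `15` and `16` apart.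
The labels of `(1; 15, 15)` form a subgroup `K` that contains `g ^ 15` and, since `a₂` and `b₂`
agree at the points `3` and `5`, the conjugates of `h g⁻¹` by `g ^ 3` and `g ^ 5`. So `h g⁻¹`, which
is a label of `(1; 16, 15)`, is in `K`. -/
theorem label_one_of_isNilpotent {G : Type*} [Group G] [Finite G] [Group.IsNilpotent G]
    {R : Transf 16 → G → Prop} (hmul : ∀ {f g x y}, R f x → R g y → R (f * g) (x * y))
    (htot : ∀ i j, ∃ x, R (Transf.unit i j) x) {g h : G} (ha : R a₂ g) (hb : R b₂ h) :
    R (Transf.unit 15 14) 1 := by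
  have hone := label_one hmul htot
  have hinv := fun {i j x} => label_inv (i := i) (j := j) (x := x) hmul htot
  have comp : ∀ {i j k x y}, R (Transf.unit i j) x → R (Transf.unit j k) y →
      R (Transf.unit i k) (x * y) := fun hx hy => by
    have := hmul hx hy
    rwa [Transf.unit_mul_unit] at this
  -- `g` labels every arrow of `a₂` and `h` every arrow of `b₂`; `p k` follows the cycle of `a₂`
  -- from `15` for `k` steps
  have ea : ∀ i j, a₂ (some i) = some j → R (Transf.unit i j) g := fun i j hij => by
    have := hmul (hone i) ha
    rwa [Transf.unit_mul rfl hij, one_mul] at this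
  have eb : ∀ i j, b₂ (some i) = some j → R (Transf.unit i j) h := fun i j hij => by
    have := hmul (hone i) hb
    rwa [Transf.unit_mul rfl hij, one_mul] at this
  have step : ∀ {i j : Fin 16} {k : ℕ}, a₂ (some i) = some j → R (Transf.unit 14 i) (g ^ k) →
      R (Transf.unit 14 j) (g ^ (k + 1)) := fun hij hk => by
    rw [pow_succ]
    exact comp hk (ea _ _ hij)
  have p1 : R (Transf.unit 14 0) (g ^ 1) := by rw [pow_one]; exact ea _ _ (by decide)
  have p3 : R (Transf.unit 14 2) (g ^ 3) :=
    step (i := 1) (by decide) (step (i := 0) (by decide) p1)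
  have p5 : R (Transf.unit 14 4) (g ^ 5) :=
    step (i := 3) (by decide) (step (i := 2) (by decide) p3)
  have p9 : R (Transf.unit 14 8) (g ^ 9) :=
    step (i := 7) (by decide) (step (i := 6) (by decide) (step (i := 5) (by decide)
      (step (i := 4) (by decide) p5)))
  have p15 : R (Transf.unit 14 14) (g ^ 15) :=
    step (i := 13) (by decide) (step (i := 12) (by decide) (step (i := 11) (by decide)
      (step (i := 10) (by decide) (step (i := 9) (by decide) (step (i := 8) (by decide) p9)))))
  let K : Subgroup G :=
    { carrier := {x | R (Transf.unit 14 14) x}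
      mul_mem' := comp
      one_mem' := hone 14
      inv_mem' := hinv }
  have conj : ∀ {i j : Fin 16} {k : ℕ}, R (Transf.unit 14 i) (g ^ k) → a₂ (some i) = some j →
      b₂ (some i) = some j → g ^ k * (h * g⁻¹) * (g ^ k)⁻¹ ∈ K := fun hk hij hij' =>
    comp (comp hk (comp (eb _ _ hij') (hinv (ea _ _ hij)))) (hinv hk)
  have hu : h * g⁻¹ ∈ K :=
    mem_of_conj_mem K p15 (conj p3 (by decide) (by decide : b₂ (some 2) = some 3))
      (conj p5 (by decide) (by decide : b₂ (some 4) = some 5))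
  have h16 : R (Transf.unit 15 14) (h * g⁻¹) :=
    comp (eb 15 0 (by decide)) (hinv (ea 14 0 (by decide)))
  have := comp h16 (K.inv_mem hu)
  rwa [mul_inv_cancel] at this

theorem N₂_not_mem_malcevProduct : ¬ (malcevProduct J.{0} Gnil.{0}).Mem N₂ := by
  rintro ⟨-, -, T, _, ⟨hfin, G, _, hG, ⟨e⟩⟩, τ, hτ⟩
  have : Finite G := Finite.of_equiv T e.toEquiv
  let R : Transf 16 → G → Prop := fun f x => ∃ hf : f ∈ N₂, (⟨f, hf⟩, e.symm x) ∈ τ.graph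
  have hmul : ∀ {f g x y}, R f x → R g y → R (f * g) (x * y) := by
    rintro f g x y ⟨hf, hx⟩ ⟨hg, hy⟩
    refine ⟨mul_mem hf hg, ?_⟩
    rw [map_mul]
    exact mul_mem hx hy
  have htot' : ∀ {f}, f ∈ N₂ → ∃ x, R f x := fun {f} hf => by
    obtain ⟨t, ht⟩ := τ.total ⟨f, hf⟩
    exact ⟨e t, hf, by rwa [e.symm_apply_apply]⟩
  have htot : ∀ i j, ∃ x, R (Transf.unit i j) x := fun i j => htot' (Or.inl (Transf.unit_mem i j))
  obtain ⟨g, hg⟩ := htot' a₂_mem_N₂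
  obtain ⟨h, hh⟩ := htot' b₂_mem_N₂
  have h1 := label_one_of_isNilpotent hmul htot hg hh
  have h2 := label_inv hmul htot h1
  rw [inv_one] at h2
  have h3 := hmul h2 h1
  rw [Transf.unit_mul_unit, mul_one] at h3
  have he : IsIdempotentElem (e.symm 1) := by
    rw [IsIdempotentElem, ← map_mul, mul_one]
  -- two distinct `𝒥`-equivalent elements of the preimage of the identity
  let x : τ.preimage (e.symm 1) he := ⟨⟨Transf.unit 15 14, h1.1⟩, h1.2⟩
  let y : τ.preimage (e.symm 1) he := ⟨⟨Transf.unit 14 14, h3.1⟩, h3.2⟩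
  let w : τ.preimage (e.symm 1) he := ⟨⟨Transf.unit 14 15, h2.1⟩, h2.2⟩
  have hxy : x = x * y := Subtype.ext (Subtype.ext (Transf.unit_mul_unit _ _ _).symm)
  have hyx : y = w * x := Subtype.ext (Subtype.ext (Transf.unit_mul_unit _ _ _).symm)
  have := (hτ _ he ⟨x⟩).2.2 x y
    ⟨x, 1, by rw [mul_one, ← WithOne.coe_mul, ← hxy]⟩
    ⟨w, 1, by rw [mul_one, ← WithOne.coe_mul, ← hyx]⟩
  exact absurd (Transf.unit_injective (congrArg (fun a => a.1.1) this)).1 (by decide)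

/-! ### Mal'cev nilpotency by shifts -/

/-- The points that `f` does not send to `θ`. -/
def Transf.dom {n : ℕ} (f : Transf n) : Finset (Fin n) :=
  Finset.univ.filter fun i => (f (some i)).isSome

theorem Transf.mem_dom {n : ℕ} {f : Transf n} {i : Fin n} :
    i ∈ f.dom ↔ ∃ j, f (some i) = some j := by
  simp [Transf.dom, Option.isSome_iff_exists]

theorem Transf.dom_mul_subset {n : ℕ} {f g : Transf n} (hg : g none = none) :
    (f * g).dom ⊆ f.dom := by
  intro i hi
  obtain ⟨k, hk⟩ := Transf.mem_dom.1 hi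
  rw [Transf.mul_apply] at hk
  cases hj : f (some i) with
  | none => rw [hj, hg] at hk; cases hk
  | some j => exact Transf.mem_dom.2 ⟨j, hj⟩

/-- A partial injection with a shift that is the identity, or whose domain and whose image contain
at most one point of each fiber of `π`. -/
structure IsNarrow {n m : ℕ} (π : Fin n → ZMod m) (f : Transf n) : Prop where
  inj : f.IsPartialInj
  shift : ∃ s, HasShift π f s
  dom : f = Transf.id n ∨ ∀ i j k l, f (some i) = some k → f (some j) = some l → π i = π j → i = j
  im : f = Transf.id n ∨ ∀ i j k l, f (some i) = some k → f (some j) = some l → π k = π l → k = l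

theorem surjOn_of_injOn_of_injOn {α : Type*} {A B : Finset α} {F F' : α → α}
    (hF : Set.MapsTo F A B) (hF' : Set.MapsTo F' B A) (hi : Set.InjOn F A) (hi' : Set.InjOn F' B) :
    Set.SurjOn F A B :=
  Finset.surjOn_of_injOn_of_card_le F hF hi (Finset.card_le_card_of_injOn F' hF' hi')

/-- If `f` maps `A` into `B` and `g` maps `B` into `A`, both injectively, then `f` maps `A` onto
`B`. -/
theorem exists_preimage {n : ℕ} {A B : Finset (Fin n)} {f g : Transf n} (hf : f.IsPartialInj)
    (hg : g.IsPartialInj) (hAB : ∀ i ∈ A, ∃ j ∈ B, f (some i) = some j)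
    (hBA : ∀ i ∈ B, ∃ j ∈ A, g (some i) = some j) : ∀ j ∈ B, ∃ i ∈ A, f (some i) = some j := by
  choose! F hF hF' using hAB
  choose! F' hG hG' using hBA
  intro j hj
  obtain ⟨i, hi, rfl⟩ := surjOn_of_injOn_of_injOn hF hG
    (fun i hi j hj h => hf.2 i j (F j) (by rw [hF' i hi, h]) (hF' j hj))
    (fun i hi j hj h => hg.2 i j (F' j) (by rw [hG' i hi, h]) (hG' j hj)) hj
  exact ⟨i, hi, hF' i hi⟩

/-- Transformations with the same domain and shift agree, when values in the same fiber do. -/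
theorem eq_of_dom_subset {n m : ℕ} {π : Fin n → ZMod m} {f g : Transf n} {s : ZMod m}
    (hf0 : f none = none) (hg0 : g none = none) (hf : HasShift π f s) (hg : HasShift π g s)
    (hfg : f.dom ⊆ g.dom) (hgf : g.dom ⊆ f.dom)
    (h : ∀ i j j', f (some i) = some j → g (some i) = some j' → π j = π j' → j = j') : f = g := by
  funext x
  cases x with
  | none => rw [hf0, hg0]
  | some i =>
    by_cases hi : i ∈ f.dom
    · obtain ⟨j, hj⟩ := Transf.mem_dom.1 hi
      obtain ⟨j', hj'⟩ := Transf.mem_dom.1 (hfg hi)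
      rw [hj, hj', h i j j' hj hj' (by rw [hf i j hj, hg i j' hj'])]
    · have hi' : i ∉ g.dom := fun h => hi (hgf h)
      rw [Transf.mem_dom, not_exists] at hi hi'
      rw [Option.eq_none_iff_forall_ne_some.2 hi, Option.eq_none_iff_forall_ne_some.2 hi']

/-- If the domain of `f z g` is that of `f`, then `z` maps `im f` into `dom g`. -/
theorem exists_of_dom_subset {n : ℕ} {f z g : Transf n} (hg : g none = none)
    (h : f.dom ⊆ (f * z * g).dom) {i j : Fin n} (hij : f (some i) = some j) :
    ∃ k ∈ g.dom, z (some j) = some k := by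
  obtain ⟨l, hl⟩ := Transf.mem_dom.1 (h (Transf.mem_dom.2 ⟨j, hij⟩))
  rw [Transf.mul_apply, Transf.mul_apply, hij] at hl
  cases hk : z (some j) with
  | none => rw [hk, hg] at hl; cases hl
  | some k => exact ⟨k, Transf.mem_dom.2 ⟨l, by rwa [hk] at hl⟩, rfl⟩

/-- The projections to an odd cyclic group of two sets that a translation exchanges agree. -/
theorem exists_of_translate {n m : ℕ} {π : Fin n → ZMod m} (hm : Odd m) {A B : Finset (Fin n)}
    {w : ZMod m} (hAB : ∀ i ∈ A, ∃ j ∈ B, π j = π i + w) (hBA : ∀ i ∈ B, ∃ j ∈ A, π j = π i + w) :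
    ∀ i ∈ A, ∃ j ∈ B, π j = π i := by
  intro i hi
  -- `m` translations by `w`, an odd number of them, lead from `A` to `B` and have no effect
  have key : ∀ k : ℕ, ∃ j ∈ A, π j = π i + (2 * k : ℕ) * w := by
    intro k
    induction k with
    | zero => exact ⟨i, hi, by simp⟩
    | succ k ih =>
      obtain ⟨j, hj, h⟩ := ih
      obtain ⟨j', hj', h'⟩ := hAB j hj
      obtain ⟨j'', hj'', h''⟩ := hBA j' hj'
      exact ⟨j'', hj'', by rw [h'', h', h]; push_cast; ring⟩
  obtain ⟨r, hr⟩ := hm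
  obtain ⟨j, hj, h⟩ := key r
  obtain ⟨j', hj', h'⟩ := hAB j hj
  refine ⟨j', hj', ?_⟩
  have : ((2 * r + 1 : ℕ) : ZMod m) = 0 := by rw [← hr, ZMod.natCast_self]
  push_cast at this h
  rw [h', h]
  linear_combination w * this

section

variable {n m : ℕ} {π : Fin n → ZMod m} {f g z z' : Transf n} {s : ZMod m}

/-- If the domains of `f` and `g` do not shrink in `f z g` and `g z f`, then `z` maps `im f`
onto `dom g`. -/
theorem exists_mul_eq (hf : IsNarrow π f) (hg : IsNarrow π g) (hz : IsNarrow π z)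
    (h1 : f.dom ⊆ (f * z * g).dom) (h2 : g.dom ⊆ (g * z * f).dom) :
    ∀ k ∈ g.dom, ∃ i j, f (some i) = some j ∧ z (some j) = some k := by
  have aux : ∀ {f g : Transf n}, IsNarrow π f → IsNarrow π g → f.dom ⊆ (f * z * g).dom →
      ∀ i ∈ f.dom, ∃ k ∈ g.dom, (f * z) (some i) = some k := by
    intro f g hf hg h1 i hi
    obtain ⟨j, hj⟩ := Transf.mem_dom.1 hi
    obtain ⟨k, hk, hjk⟩ := exists_of_dom_subset hg.inj.1 h1 hj
    exact ⟨k, hk, by rw [Transf.mul_apply, hj, hjk]⟩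
  intro k hk
  obtain ⟨i, hi, hik⟩ := exists_preimage (hf.inj.mul hz.inj) (hg.inj.mul hz.inj)
    (aux hf hg h1) (aux hg hf h2) k hk
  obtain ⟨j, hj⟩ := Transf.mem_dom.1 hi
  rw [Transf.mul_apply, hj] at hik
  exact ⟨i, j, hj, hik⟩

/-- Both domains lie in the image of `z`, which meets every fiber of `π` at most once, and their
projections are exchanged by a translation of the odd cyclic group. -/
theorem dom_subset_of_ne_id (hm : Odd m) (hf : IsNarrow π f) (hg : IsNarrow π g)
    (hz : IsNarrow π z) (hz1 : z ≠ Transf.id n) (hfs : HasShift π f s) (hgs : HasShift π g s)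
    (h1 : f.dom ⊆ (f * z * g).dom) (h2 : g.dom ⊆ (g * z * f).dom) : f.dom ⊆ g.dom := by
  obtain ⟨t, ht⟩ := hz.shift
  have aux : ∀ {f g : Transf n}, IsNarrow π g → HasShift π f s → f.dom ⊆ (f * z * g).dom →
      ∀ i ∈ f.dom, ∃ k ∈ g.dom, π k = π i + (s + t) := by
    intro f g hg hfs h1 i hi
    obtain ⟨j, hj⟩ := Transf.mem_dom.1 hi
    obtain ⟨k, hk, hjk⟩ := exists_of_dom_subset hg.inj.1 h1 hj
    exact ⟨k, hk, by rw [ht j k hjk, hfs i j hj, add_assoc]⟩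
  intro i hi
  obtain ⟨j, hj, hij⟩ := exists_of_translate hm (aux hg hfs h1) (aux hf hgs h2) i hi
  obtain ⟨-, p, -, hp⟩ := exists_mul_eq hg hf hz h2 h1 i hi
  obtain ⟨-, q, -, hq⟩ := exists_mul_eq hf hg hz h1 h2 j hj
  rwa [← (hz.im.resolve_left hz1) q p j i hq hp hij]

theorem eq_of_ne_id (hm : Odd m) (hf : IsNarrow π f) (hg : IsNarrow π g)
    (hz : IsNarrow π z) (hz1 : z ≠ Transf.id n) (hfs : HasShift π f s) (hgs : HasShift π g s)
    (h1 : f.dom ⊆ (f * z * g).dom) (h2 : g.dom ⊆ (g * z * f).dom) : f = g := by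
  refine eq_of_dom_subset hf.inj.1 hg.inj.1 hfs hgs
    (dom_subset_of_ne_id hm hf hg hz hz1 hfs hgs h1 h2)
    (dom_subset_of_ne_id hm hg hf hz hz1 hgs hfs h2 h1) fun i j j' hj hj' hjj => ?_
  obtain ⟨k, -, hk⟩ := exists_of_dom_subset hg.inj.1 h1 hj
  obtain ⟨k', -, hk'⟩ := exists_of_dom_subset hf.inj.1 h2 hj'
  exact (hz.dom.resolve_left hz1) j j' k k' hk hk' hjj

/-- For the parameter `1`, the images of `f` and `g` are the domains of `g` and `f`; a second step
with parameter `1` makes these two sets equal. -/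
theorem dom_subset_of_id (hf : IsNarrow π f) (hg : IsNarrow π g)
    (h1 : f.dom ⊆ (f * g).dom) (h2 : g.dom ⊆ (g * f).dom)
    (h3 : (f * g).dom ⊆ (f * g * (g * f)).dom) : f.dom ⊆ g.dom := by
  have hid : IsNarrow π (Transf.id n) :=
    ⟨Transf.isPartialInj_id n, ⟨0, hasShift_id π⟩, Or.inl rfl, Or.inl rfl⟩
  intro k hk
  -- write `k` as the image of `i` under `g`, and `i` as the image of `p` under `f`
  obtain ⟨i, j, hij, hjk⟩ := exists_mul_eq hg hf hid h2 h1 k hk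
  obtain rfl : j = k := Option.some_injective _ hjk
  obtain ⟨p, q, hpq, hqi⟩ := exists_mul_eq hf hg hid h1 h2 i (Transf.mem_dom.2 ⟨j, hij⟩)
  obtain rfl : q = i := Option.some_injective _ hqi
  have hpj : (f * g) (some p) = some j := by rw [Transf.mul_apply, hpq, hij]
  obtain ⟨l, hl, hjl⟩ := exists_of_dom_subset (z := Transf.id n)
    (hg.inj.mul hf.inj).1 h3 hpj
  obtain rfl : j = l := Option.some_injective _ hjl
  exact Transf.dom_mul_subset hf.inj.1 hl

theorem eq_of_id (hf : IsNarrow π f) (hg : IsNarrow π g) (hfs : HasShift π f s)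
    (hgs : HasShift π g s) (h1 : f.dom ⊆ (f * g).dom) (h2 : g.dom ⊆ (g * f).dom)
    (h3 : (f * g).dom ⊆ (f * g * (g * f)).dom) (h4 : (g * f).dom ⊆ (g * f * (f * g)).dom) :
    f = g := by
  have hfg := dom_subset_of_id hf hg h1 h2 h3
  have hgf := dom_subset_of_id hg hf h2 h1 h4
  refine eq_of_dom_subset hf.inj.1 hg.inj.1 hfs hgs hfg hgf fun i j j' hj hj' hjj => ?_
  have hjg : j ∈ g.dom := by
    obtain ⟨l, hl, e⟩ := exists_of_dom_subset (z := Transf.id n) hg.inj.1 h1 hj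
    rwa [Option.some_injective _ (show some j = some l from e)]
  have hjf' : j' ∈ f.dom := by
    obtain ⟨l, hl, e⟩ := exists_of_dom_subset (z := Transf.id n) hf.inj.1 h2 hj'
    rwa [Option.some_injective _ (show some j' = some l from e)]
  rcases hf.dom with hf1 | hf1
  · rcases hg.dom with hg1 | hg1
    · subst hf1 hg1
      exact Option.some_injective _ (hj.symm.trans hj')
    · obtain ⟨k, hk⟩ := Transf.mem_dom.1 hjg
      obtain ⟨k', hk'⟩ := Transf.mem_dom.1 (hfg hjf')
      exact hg1 j j' k k' hk hk' hjj
  · obtain ⟨k, hk⟩ := Transf.mem_dom.1 (hgf hjg)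
    obtain ⟨k', hk'⟩ := Transf.mem_dom.1 hjf'
    exact hf1 j j' k k' hk hk' hjj

/-- If no domain shrinks in two consecutive steps, the two words agree. -/
theorem mul_mul_eq_of_dom_subset (hm : Odd m) (hf : IsNarrow π f) (hg : IsNarrow π g)
    (hz : IsNarrow π z) (hz' : IsNarrow π z') (hf' : IsNarrow π (f * z * g))
    (hg' : IsNarrow π (g * z * f)) (hfs : HasShift π f s) (hgs : HasShift π g s)
    (h1 : f.dom ⊆ (f * z * g).dom) (h2 : g.dom ⊆ (g * z * f).dom)
    (h3 : (f * z * g).dom ⊆ (f * z * g * z' * (g * z * f)).dom)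
    (h4 : (g * z * f).dom ⊆ (g * z * f * z' * (f * z * g)).dom) : f * z * g = g * z * f := by
  by_cases hz1 : z = Transf.id n
  · by_cases hz1' : z' = Transf.id n
    · rw [eq_of_id (s := s) hf hg hfs hgs] <;> subst hz1 hz1' <;> assumption
    · obtain ⟨t, ht⟩ := hz.shift
      have hgs' := ((hgs.mul ht hz.inj.1).mul hfs hf.inj.1)
      exact eq_of_ne_id hm hf' hg' hz' hz1' ((hfs.mul ht hz.inj.1).mul hgs hg.inj.1) hgs' h3 h4
  · rw [eq_of_ne_id hm hf hg hz hz1 hfs hgs h1 h2]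

end

/-- A monoid of narrow transformations over an odd cyclic group is nilpotent: the domains of the
two words decrease, and as soon as they are constant for two steps, the words agree. -/
theorem isMalcevNilpotent_of_isNarrow {n m : ℕ} {π : Fin n → ZMod m} (hm : Odd m)
    {S : Subsemigroup (Transf n)} (hS : 1 ∈ S) (h : ∀ f ∈ S, IsNarrow π f) :
    IsMalcevNilpotent S := by
  rw [isMalcevNilpotent_iff hS]
  -- the two domains have at most `2 * n` points together, one of which is lost in every two steps;
  -- the first step gives the two words the same shift
  refine ⟨4 * n + 4, by omega, fun x hx y hy z hz => ?_⟩
  by_contra hne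
  let l : ℕ → Transf n := fun k => (malcevSeq x y z k).1
  let r : ℕ → Transf n := fun k => (malcevSeq x y z k).2
  have hl : ∀ k, l (k + 1) = l k * z k * r k := fun _ => rfl
  have hr : ∀ k, r (k + 1) = r k * z k * l k := fun _ => rfl
  have hne' : ∀ k ≤ 4 * n + 4, l k ≠ r k := fun k hk e => hne (malcevSeq_eq_of_le x y z hk e)
  have hmem : ∀ k, l k ∈ S ∧ r k ∈ S := by
    intro k
    induction k with
    | zero => exact ⟨hx, hy⟩
    | succ k ih =>
      exact ⟨mul_mem (mul_mem ih.1 (hz k)) ih.2, mul_mem (mul_mem ih.2 (hz k)) ih.1⟩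
  have nl := fun k => h _ (hmem k).1
  have nr := fun k => h _ (hmem k).2
  have nz := fun k => h _ (hz k)
  have shift : ∀ k, ∃ s, HasShift π (l (k + 1)) s ∧ HasShift π (r (k + 1)) s := by
    intro k
    obtain ⟨s, hs⟩ := (nl k).shift
    obtain ⟨t, ht⟩ := (nr k).shift
    obtain ⟨u, hu⟩ := (nz k).shift
    refine ⟨s + u + t, (hs.mul hu (nz k).inj.1).mul ht (nr k).inj.1, ?_⟩
    rw [show s + u + t = t + u + s by ring]
    exact (ht.mul hu (nz k).inj.1).mul hs (nl k).inj.1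
  have subl : ∀ k, (l (k + 1)).dom ⊆ (l k).dom := fun k => by
    rw [hl, mul_assoc]
    exact Transf.dom_mul_subset ((nz k).inj.mul (nr k).inj).1
  have subr : ∀ k, (r (k + 1)).dom ⊆ (r k).dom := fun k => by
    rw [hr, mul_assoc]
    exact Transf.dom_mul_subset ((nz k).inj.mul (nl k).inj).1
  let c : ℕ → ℕ := fun k => (l k).dom.card + (r k).dom.card
  have anti : ∀ k, c (k + 1) ≤ c k := fun k =>
    add_le_add (Finset.card_le_card (subl k)) (Finset.card_le_card (subr k))
  have stable : ∀ k, c k ≤ c (k + 1) → (l k).dom ⊆ (l (k + 1)).dom ∧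
      (r k).dom ⊆ (r (k + 1)).dom := by
    intro k hk
    have h1 := Finset.card_le_card (subl k)
    have h2 := Finset.card_le_card (subr k)
    simp only [c] at hk
    exact ⟨(Finset.eq_of_subset_of_card_le (subl k) (by omega)).ge,
      (Finset.eq_of_subset_of_card_le (subr k) (by omega)).ge⟩
  have drop : ∀ k, k + 2 ≤ 4 * n + 4 → c (k + 3) < c (k + 1) := by
    intro k hk
    by_contra! hc
    obtain ⟨h1, h2⟩ := stable (k + 1) (hc.trans (anti (k + 2)))
    obtain ⟨h3, h4⟩ := stable (k + 2) ((anti (k + 1)).trans hc)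
    obtain ⟨s, hs, ht⟩ := shift k
    have e := hne' (k + 2) hk
    rw [hl, hr] at e
    rw [hl (k + 2), hl (k + 1), hr (k + 1)] at h3
    rw [hr (k + 2), hl (k + 1), hr (k + 1)] at h4
    rw [hl (k + 1)] at h1
    rw [hr (k + 1)] at h2
    exact e (mul_mul_eq_of_dom_subset (f := l (k + 1)) (g := r (k + 1)) (z := z (k + 1))
      hm (nl _) (nr _) (nz _) (nz (k + 2)) (nl (k + 2)) (nr (k + 2)) hs ht h1 h2 h3 h4)
  have bound : ∀ k, k ≤ 2 * n + 1 → c (2 * k + 1) + k ≤ 2 * n := by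
    intro k
    induction k with
    | zero =>
      intro _
      have h1 := Finset.card_le_univ (l 1).dom
      have h2 := Finset.card_le_univ (r 1).dom
      rw [Fintype.card_fin] at h1 h2
      change (l 1).dom.card + (r 1).dom.card + 0 ≤ 2 * n
      omega
    | succ k ih =>
      intro hk
      have h1 := ih (by omega)
      have h2 := drop (2 * k) (by omega)
      rw [show 2 * (k + 1) + 1 = 2 * k + 3 by ring]
      omega
  have := bound (2 * n + 1) le_rfl
  omega

/-! ### The semigroup `N₂` is nilpotent -/

/-- The place in `ℤ/15` of a point of `{1, …, 16}`: the points `15` and `16` coincide. -/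
def place₁₅ (i : Fin 16) : ZMod 15 := if i = 15 then 14 else (i : ℕ)

theorem place₁₅_eq_iff {i j : Fin 16} :
    place₁₅ i = place₁₅ j ↔ i = j ∨ (i = 14 ∧ j = 15) ∨ (i = 15 ∧ j = 14) := by
  revert i j
  decide

/-- The elements of `⟨a₂, b₂⟩` have a shift, their domain does not contain both `15` and `16`, and
their image does not contain `16`. -/
theorem closure_props {f : Transf 16} (hf : f ∈ Subsemigroup.closure {a₂, b₂}) :
    (∃ s, HasShift place₁₅ f s) ∧ (f (some 14) = none ∨ f (some 15) = none) ∧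
      ∀ i, f (some i) ≠ some 15 := by
  induction hf using Subsemigroup.closure_induction with
  | mem f hf =>
    rcases hf with rfl | rfl
    · exact ⟨⟨1, by simp only [HasShift, a₂, Transf.ofFun]; decide⟩, by decide,
        by simp only [a₂, Transf.ofFun]; decide⟩
    · exact ⟨⟨1, by simp only [HasShift, b₂, Transf.ofFun]; decide⟩, by decide,
        by simp only [b₂, Transf.ofFun]; decide⟩
  | mul f g _ hg hf' hg' =>
    obtain ⟨⟨s, hs⟩, hd, -⟩ := hf'
    obtain ⟨⟨t, ht⟩, -, hi⟩ := hg'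
    have hg0 := (isPartialInj_closure g hg).1
    refine ⟨⟨s + t, hs.mul ht hg0⟩, hd.imp (fun h => ?_) (fun h => ?_), fun i h => ?_⟩
    · rw [Transf.mul_apply, h, hg0]
    · rw [Transf.mul_apply, h, hg0]
    · rw [Transf.mul_apply] at h
      cases hj : f (some i) with
      | none => rw [hj, hg0] at h; cases h
      | some j => rw [hj] at h; exact hi j h

theorem isNarrow_of_mem_N₂ {f : Transf 16} (hf : f ∈ N₂) : IsNarrow place₁₅ f := by
  rcases hf with hf | hf | rfl
  · have hinj := Transf.isPartialInj_of_mem_brandt hf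
    have : ∀ i j k l, f (some i) = some k → f (some j) = some l → i = j ∧ k = l := by
      rcases hf with rfl | ⟨a, b, rfl⟩
      · intro i j k l h
        cases h
      · intro i j k l h h'
        obtain ⟨rfl, rfl⟩ := Transf.unit_apply_eq_some.1 h
        obtain ⟨rfl, rfl⟩ := Transf.unit_apply_eq_some.1 h'
        exact ⟨rfl, rfl⟩
    exact ⟨hinj, exists_hasShift_of_mem_brandt _ hf, Or.inr fun i j k l h h' _ =>
      (this i j k l h h').1, Or.inr fun i j k l h h' _ => (this i j k l h h').2⟩
  · obtain ⟨hs, hd, hi⟩ := closure_props hf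
    refine ⟨isPartialInj_closure f hf, hs, Or.inr fun i j k l h h' e => ?_,
      Or.inr fun i j k l h h' e => ?_⟩
    · rcases place₁₅_eq_iff.1 e with rfl | ⟨rfl, rfl⟩ | ⟨rfl, rfl⟩
      · rfl
      · rcases hd with hd | hd <;> simp [hd] at h h'
      · rcases hd with hd | hd <;> simp [hd] at h h'
    · rcases place₁₅_eq_iff.1 e with rfl | ⟨rfl, rfl⟩ | ⟨rfl, rfl⟩
      · rfl
      · exact absurd h' (hi j)
      · exact absurd h (hi i)
  · exact ⟨Transf.isPartialInj_id 16, ⟨0, hasShift_id _⟩, Or.inl rfl, Or.inl rfl⟩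

theorem N₂_mem_MN : MN.{0}.Mem N₂ := by
  have h1 : (1 : Transf 16) ∈ N₂ := by right; right; rfl
  exact ⟨inferInstance, ⟨⟨1, h1⟩⟩,
    isMalcevNilpotent_of_isNarrow (by decide : Odd 15) h1 fun f hf => isNarrow_of_mem_N₂ hf⟩

end FinSemigroup

theorem mainTheorem5 :
    -- the pseudovarieties are incomparable
    (¬ FinSemigroup.MN.{0} ≤ FinSemigroup.malcevProduct FinSemigroup.J FinSemigroup.Gnil ∧
      ¬ FinSemigroup.malcevProduct FinSemigroup.J FinSemigroup.Gnil ≤ FinSemigroup.MN.{0}) ∧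
    -- as witnessed by the following two semigroups
    (FinSemigroup.MN.Mem FinSemigroup.N₂ ∧
      ¬ (FinSemigroup.malcevProduct FinSemigroup.J FinSemigroup.Gnil).Mem FinSemigroup.N₂) ∧
    ((FinSemigroup.malcevProduct FinSemigroup.J FinSemigroup.Gnil).Mem FinSemigroup.M₃ ∧
      ¬ FinSemigroup.MN.Mem FinSemigroup.M₃) :=
  ⟨⟨fun h => FinSemigroup.N₂_not_mem_malcevProduct (h _ FinSemigroup.N₂_mem_MN),
      fun h => FinSemigroup.M₃_not_mem_MN (h _ FinSemigroup.M₃_mem_malcevProduct)⟩,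
    ⟨FinSemigroup.N₂_mem_MN, FinSemigroup.N₂_not_mem_malcevProduct⟩,
    ⟨FinSemigroup.M₃_mem_malcevProduct, FinSemigroup.M₃_not_mem_MN⟩⟩
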